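/- Let $(M,g)$ be a Riemannian $n$-manifold ($n\ge 3$) with sectional curvature $K$. For a subspace $L\subseteq T_pM$ with orthonormal basis $e_1,\dots,e_r$ put $\tau(L)=\sum_{\alpha<\beta}K(e_\alpha\wedge e_\beta)$, and $\tau(p)=\tau(T_pM)$. Let $\mathcal S(n)$ be the set of all tuples $(n_1,\dots,n_k)$, $k\ge 1$, of integers with $2\le n_j<n$ and $n_1+\cdots+n_k\le n$. For such a tuple put $$\delta(n_1,\dots,n_k)(p)=\tau(p)-\inf\{\tau(L_1)+\cdots+\tau(L_k)\},$$ where $L_1,\dots,L_k$ run over all mutually orthogonal subspaces of $T_pM$ with $\dim L_j=n_j$. A (smooth) isometric immersion $f:M\to\mathbb E^m$ with mean curvature vector $\vec H=\frac1n\operatorname{trace}h$, where $h$ is the second fundamental form, is called ideal if for some $(n_1,\dots,n_k)\in\mathcal S(n)$ the equality $$\delta(n_1,\dots,n_k)(p)=\frac{n^2\,(n+k-1-\sum_j n_j)}{2\,(n+k-\sum_j n_j)}\,|\vec H(p)|^2$$ holds at every point $p\in M$. Two isometric immersions $f_1,f_2:M\to\mathbb E^m$ are congruent if $f_2=\Phi\circ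 f_1$ for some isometry $\Phi$ of $\mathbb E^m$. **Corollary.** For every integer $n\ge 3$ there exists a connected Riemannian $n$-manifold $M$ which admits two non-congruent ideal immersions into $\mathbb E^{n+1}$. -/

import Mathlib

open scoped Manifold ContDiff

noncomputable section

namespace Riem

/- The manifold structure of a vector space is always the standard one. -/
attribute [local instance 2000] chartedSpaceSelf

/-- A smooth Riemannian metric on the smooth `n`-manifold `M`. -/
abbrev Metric (n : ℕ) (M : Type*) [TopologicalSpace M] [ChartedSpace (EuclideanSpace ℝ (Fin n)) M]
    [IsManifold (𝓡 n) ∞ M] :=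
  Bundle.ContMDiffRiemannianMetric (𝓡 n) ∞ (EuclideanSpace ℝ (Fin n))
    (fun p : M => TangentSpace (𝓡 n) p)

section Intrinsic

variable {n : ℕ} {M : Type*} [TopologicalSpace M] [ChartedSpace (EuclideanSpace ℝ (Fin n)) M]
  [IsManifold (𝓡 n) ∞ M]

/-- Coordinate components of a tangent vector at `p`. In Mathlib `TangentSpace (𝓡 n) p` is the
model space `ℝⁿ`, the identification being the differential at `p` of the preferred chart at `p`. -/
def comp (p : M) (v : TangentSpace (𝓡 n) p) : EuclideanSpace ℝ (Fin n) := v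

/-- The coordinate field `∂ᵢ` of the preferred chart at `p`, at the point with coordinates `y`. -/
def coordField (p : M) (y : EuclideanSpace ℝ (Fin n)) (i : Fin n) :
    TangentSpace (𝓡 n) ((extChartAt (𝓡 n) p).symm y) :=
  mfderiv 𝓘(ℝ, EuclideanSpace ℝ (Fin n)) (𝓡 n) (extChartAt (𝓡 n) p).symm y
    (EuclideanSpace.single i (1 : ℝ))

variable (g : Metric n M)

/-- The matrix `gᵢⱼ(y)` of the metric in the preferred chart at `p`. -/
def gram (p : M) (y : EuclideanSpace ℝ (Fin n)) : Matrix (Fin n) (Fin n) ℝ :=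
  Matrix.of fun i j =>
    g.inner ((extChartAt (𝓡 n) p).symm y) (coordField p y i) (coordField p y j)

/-- `∂ₖ F (y)`. -/
def partialDeriv (F : EuclideanSpace ℝ (Fin n) → ℝ) (k : Fin n) (y : EuclideanSpace ℝ (Fin n)) :
    ℝ :=
  fderiv ℝ F y (EuclideanSpace.single k (1 : ℝ))

/-- Christoffel symbols `Γˡᵢⱼ = ½ ∑ₘ gˡᵐ (∂ᵢ gⱼₘ + ∂ⱼ gᵢₘ - ∂ₘ gᵢⱼ)` of the Levi-Civita connection,
in the preferred chart at `p`. -/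
def christoffel (p : M) (l i j : Fin n) (y : EuclideanSpace ℝ (Fin n)) : ℝ :=
  (1 / 2) * ∑ m, (gram g p y)⁻¹ l m *
    (partialDeriv (fun z => gram g p z j m) i y + partialDeriv (fun z => gram g p z i m) j y
      - partialDeriv (fun z => gram g p z i j) m y)

/-- Component along `∂ₗ` of `R(∂ᵢ, ∂ⱼ)∂ₖ = ∇ᵢ∇ⱼ∂ₖ - ∇ⱼ∇ᵢ∂ₖ` at `p`, in the preferred chart. -/
def curvatureCoeff (p : M) (i j k l : Fin n) : ℝ :=
  let x := extChartAt (𝓡 n) p p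
  partialDeriv (christoffel g p l j k) i x - partialDeriv (christoffel g p l i k) j x
    + ∑ m, (christoffel g p l i m x * christoffel g p m j k x
      - christoffel g p l j m x * christoffel g p m i k x)

/-- The Riemann curvature `R(u, v)w` at `p`. -/
def curvature (p : M) (u v w : TangentSpace (𝓡 n) p) : TangentSpace (𝓡 n) p :=
  (WithLp.toLp 2 fun l => ∑ i, ∑ j, ∑ k,
    comp p u i * comp p v j * comp p w k * curvatureCoeff g p i j k l : EuclideanSpace ℝ (Fin n))

/-- Sectional curvature of the plane spanned by `u` and `v` (linearly independent). -/
def sectionalCurvature (p : M) (u v : TangentSpace (𝓡 n) p) : ℝ :=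
  g.inner p (curvature g p u v v) u /
    (g.inner p u u * g.inner p v v - g.inner p u v ^ 2)

/-- `e` is a `g`-orthonormal basis of the subspace `L` of `T_p M`. -/
def IsOrthonormalBasisOf (p : M) (L : Submodule ℝ (TangentSpace (𝓡 n) p)) {r : ℕ}
    (e : Fin r → TangentSpace (𝓡 n) p) : Prop :=
  (∀ a b, g.inner p (e a) (e b) = if a = b then 1 else 0) ∧
    Submodule.span ℝ (Set.range e) = L

theorem exists_isOrthonormalBasisOf (p : M) (L : Submodule ℝ (TangentSpace (𝓡 n) p)) :
    ∃ e : Fin (Module.finrank ℝ L) → TangentSpace (𝓡 n) p, IsOrthonormalBasisOf g p L e := by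
  let c := g.toRiemannianMetric.toCore p
  let _ : NormedAddCommGroup (TangentSpace (𝓡 n) p) := c.toNormedAddCommGroup
  let _ : InnerProductSpace ℝ (TangentSpace (𝓡 n) p) := InnerProductSpace.ofCore c.toCore
  have _ : FiniteDimensional ℝ (TangentSpace (𝓡 n) p) :=
    inferInstanceAs (FiniteDimensional ℝ (EuclideanSpace ℝ (Fin n)))
  let b := stdOrthonormalBasis ℝ L
  refine ⟨fun a => (b a : TangentSpace (𝓡 n) p), fun a a' => ?_, ?_⟩
  · exact orthonormal_iff_ite.mp b.orthonormal a a'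
  · have h : Set.range (fun a => (b a : TangentSpace (𝓡 n) p)) = L.subtype '' Set.range b := by
      ext x; simp
    rw [h, Submodule.span_image, ← b.coe_toBasis, b.toBasis.span_eq, Submodule.map_subtype_top]

/-- A chosen `g`-orthonormal basis of a subspace `L` of `T_p M`. -/
def orthonormalBasisOf (p : M) (L : Submodule ℝ (TangentSpace (𝓡 n) p)) :
    Fin (Module.finrank ℝ L) → TangentSpace (𝓡 n) p :=
  (exists_isOrthonormalBasisOf g p L).choose

/-- Scalar curvature `τ(L) = ∑_{α < β} K(e_α ∧ e_β)` of a subspace `L` of `T_p M`, where `e` is an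
orthonormal basis of `L` (the value does not depend on it). -/
def scalarCurvatureOf (p : M) (L : Submodule ℝ (TangentSpace (𝓡 n) p)) : ℝ :=
  ∑ a, ∑ b, if a < b then
    sectionalCurvature g p (orthonormalBasisOf g p L a) (orthonormalBasisOf g p L b) else 0

/-- Scalar curvature `τ(p) = τ(T_p M)`. -/
def scalarCurvature (p : M) : ℝ := scalarCurvatureOf g p ⊤

/-- `L₁, …, L_k` are mutually orthogonal subspaces of `T_p M` with `dim L_j = d_j`. -/
def IsOrthogonalFamily (p : M) {k : ℕ} (d : Fin k → ℕ)
    (L : Fin k → Submodule ℝ (TangentSpace (𝓡 n) p)) : Prop :=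
  (∀ j, Module.finrank ℝ (L j) = d j) ∧
    ∀ i j, i ≠ j → ∀ u ∈ L i, ∀ v ∈ L j, g.inner p u v = 0

/-- `δ(d₁, …, d_k)(p) = τ(p) - inf {τ(L₁) + ⋯ + τ(L_k)}`. -/
def deltaInvariant {k : ℕ} (d : Fin k → ℕ) (p : M) : ℝ :=
  scalarCurvature g p -
    sInf {t : ℝ | ∃ L : Fin k → Submodule ℝ (TangentSpace (𝓡 n) p),
      IsOrthogonalFamily g p d L ∧ t = ∑ j, scalarCurvatureOf g p (L j)}

end Intrinsic

/-- `(d₁, …, d_k) ∈ 𝒮(n)`: `k ≥ 1`, all `d_j` satisfy `2 ≤ d_j < n`, and `d₁ + ⋯ + d_k ≤ n`. -/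
def IsAdmissible (n : ℕ) {k : ℕ} (d : Fin k → ℕ) : Prop :=
  1 ≤ k ∧ (∀ j, 2 ≤ d j ∧ d j < n) ∧ ∑ j, d j ≤ n

section Extrinsic

variable {n m : ℕ} {M : Type*} [TopologicalSpace M] [ChartedSpace (EuclideanSpace ℝ (Fin n)) M]
  [IsManifold (𝓡 n) ∞ M]

/-- The differential of `f : M → 𝔼ᵐ` at `p`. -/
def differential (f : M → EuclideanSpace ℝ (Fin m)) (p : M) :
    EuclideanSpace ℝ (Fin n) →L[ℝ] EuclideanSpace ℝ (Fin m) :=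
  mfderiv (𝓡 n) (𝓡 m) f p

/-- `f` is a smooth isometric immersion of `(M, g)` into `𝔼ᵐ`. (As `g` is positive definite, the
differential is automatically injective.) -/
def IsIsometricImmersion (g : Metric n M) (f : M → EuclideanSpace ℝ (Fin m)) : Prop :=
  ContMDiff (𝓡 n) (𝓡 m) ∞ f ∧
    ∀ (p : M) (u v : TangentSpace (𝓡 n) p),
      inner ℝ (differential (n := n) f p (comp p u)) (differential (n := n) f p (comp p v)) = g.inner p u v

/-- The second fundamental form `h(u, v)` at `p`: the normal component of the derivative in `𝔼ᵐ`
along `u` of `f_* V`, where `V` is the extension of `v` with constant components in the preferred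
chart at `p`. -/
def secondFundamentalForm (f : M → EuclideanSpace ℝ (Fin m)) (p : M)
    (u v : TangentSpace (𝓡 n) p) : EuclideanSpace ℝ (Fin m) :=
  (LinearMap.range (differential (n := n) f p).toLinearMap)ᗮ.starProjection
    (fderiv ℝ (fun y => fderiv ℝ (f ∘ (extChartAt (𝓡 n) p).symm) y (comp p v))
      (extChartAt (𝓡 n) p p) (comp p u))

/-- The mean curvature vector `(1/n) trace h` at `p`; the trace is taken in an orthonormal basis
of `T_p M` (the value does not depend on it). -/
def meanCurvatureVector (g : Metric n M) (f : M → EuclideanSpace ℝ (Fin m)) (p : M) :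
    EuclideanSpace ℝ (Fin m) :=
  (1 / n : ℝ) • ∑ a, secondFundamentalForm f p (orthonormalBasisOf g p ⊤ a)
    (orthonormalBasisOf g p ⊤ a)

/-- `f` is `δ(d₁, …, d_k)`-ideal: an isometric immersion for which
`δ(d₁, …, d_k) = n² (n + k - 1 - ∑ d_j) / (2 (n + k - ∑ d_j)) · H²` at every point. -/
def IsDeltaIdeal (g : Metric n M) {k : ℕ} (d : Fin k → ℕ)
    (f : M → EuclideanSpace ℝ (Fin m)) : Prop :=
  IsIsometricImmersion g f ∧ ∀ p : M,
    deltaInvariant g d p =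
      ((n : ℝ) ^ 2 * (n + k - 1 - ∑ j, (d j : ℝ))) / (2 * (n + k - ∑ j, (d j : ℝ))) *
        ‖meanCurvatureVector g f p‖ ^ 2

/-- `f` is an ideal immersion: `δ(d₁, …, d_k)`-ideal for some `(d₁, …, d_k) ∈ 𝒮(n)`. -/
def IsIdeal (g : Metric n M) (f : M → EuclideanSpace ℝ (Fin m)) : Prop :=
  ∃ (k : ℕ) (d : Fin k → ℕ), IsAdmissible n d ∧ IsDeltaIdeal g d f

/-- Two maps into `𝔼ᵐ` are congruent if they differ by an isometry of `𝔼ᵐ`. -/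
def IsCongruent (f₁ f₂ : M → EuclideanSpace ℝ (Fin m)) : Prop :=
  ∃ Φ : EuclideanSpace ℝ (Fin m) ≃ᵢ EuclideanSpace ℝ (Fin m), f₂ = Φ ∘ f₁

end Extrinsic

end Riem

end

open scoped Manifold ContDiff

/-! The catenoid (on its universal cover) and the helicoid are minimal surfaces in `ℝ³` with the
same first fundamental form `cosh² s (ds² + dt²)`. Multiplying both by a flat `ℝᵐ`, `m = n - 2`,
gives two minimal isometric immersions into `𝔼ⁿ⁺¹` of one metric on `ℝⁿ`.

Both are ideal for the tuple `(2)`. The curvature is nonpositive and concentrated in the surface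
plane, so that plane minimizes `τ(L)` over 2-planes and its value is already all of `τ(p)`. Hence
`δ(2) = 0` (`deltaInvariant_two`), and `H = 0` (`meanCurvatureVector_separatedCylinder`) turns the
required equality into `0 = 0`.

They are not congruent: the catenoid map has period `2π` in `t`, while the helicoid map has `t` as a
coordinate. -/

namespace CatenoidHelicoid

open Real

attribute [local instance 2000] chartedSpaceSelf

variable {m : ℕ}

/-! ### The product metric -/

/-- The bilinear form `dyᵢ ⊗ dyᵢ`. -/
noncomputable def coordSq {d : ℕ} (i : Fin d) :
    EuclideanSpace ℝ (Fin d) →L[ℝ] EuclideanSpace ℝ (Fin d) →L[ℝ] ℝ :=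
  let p : EuclideanSpace ℝ (Fin d) →L[ℝ] ℝ := EuclideanSpace.proj i
  p.smulRight p

lemma coordSq_apply {d : ℕ} (i : Fin d) (u v : EuclideanSpace ℝ (Fin d)) :
    coordSq i u v = u i * v i := rfl

/-- The bilinear form `cosh² y₀ (dy₀² + dy₁²) + ∑_{j ≥ 2} dyⱼ²`. -/
noncomputable def form {m : ℕ} (y : EuclideanSpace ℝ (Fin (m + 2))) :
    EuclideanSpace ℝ (Fin (m + 2)) →L[ℝ] EuclideanSpace ℝ (Fin (m + 2)) →L[ℝ] ℝ :=
  cosh (y 0) ^ 2 • (coordSq 0 + coordSq 1) + ∑ j : Fin m, coordSq j.succ.succ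

lemma form_apply (y u v : EuclideanSpace ℝ (Fin (m + 2))) :
    form y u v = cosh (y 0) ^ 2 * (u 0 * v 0 + u 1 * v 1) +
      ∑ j : Fin m, u j.succ.succ * v j.succ.succ := by
  simp only [form, add_apply, smul_apply,
    sum_apply, coordSq_apply, smul_eq_mul]

/-- Follows from `cosh² ≥ 1`. Comparison with the Euclidean form gives both positive definiteness
and boundedness of the unit balls of the metric. -/
lemma inner_self_le_form (y v : EuclideanSpace ℝ (Fin (m + 2))) :
    inner ℝ v v ≤ form y v v := by
  rw [form_apply, PiLp.inner_apply, Fin.sum_univ_succ, Fin.sum_univ_succ, cosh_sq]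
  simp only [RCLike.inner_apply, conj_trivial, Fin.succ_zero_eq_one]
  nlinarith [mul_nonneg (sq_nonneg (sinh (y 0))) (add_nonneg (sq_nonneg (v 0)) (sq_nonneg (v 1)))]

lemma contDiff_form : ContDiff ℝ ∞ (form (m := m)) := by
  have h : ContDiff ℝ ∞ fun y : EuclideanSpace ℝ (Fin (m + 2)) => y 0 :=
    (EuclideanSpace.proj (𝕜 := ℝ) (0 : Fin (m + 2))).contDiff
  exact ((ContinuousLinearMap.toSpanSingleton ℝ
    (coordSq (0 : Fin (m + 2)) + coordSq 1)).contDiff.comp (h.cosh.pow 2)).add contDiff_const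

/-- `form y` as a bilinear form on the tangent space at `y`. -/
noncomputable def tangentForm (y : EuclideanSpace ℝ (Fin (m + 2))) :
    TangentSpace (𝓡 (m + 2)) y →L[ℝ] TangentSpace (𝓡 (m + 2)) y →L[ℝ] ℝ :=
  form y

/-- The Riemannian metric `cosh² y₀ (dy₀² + dy₁²) + ∑_{j ≥ 2} dyⱼ²` on `ℝ^(m+2)`: the product of
the metric of the catenoid with a flat metric. -/
noncomputable def metric (m : ℕ) : Riem.Metric (m + 2) (EuclideanSpace ℝ (Fin (m + 2))) where
  inner y := tangentForm y
  symm y u v := by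
    have h (u v : EuclideanSpace ℝ (Fin (m + 2))) : form y u v = form y v u := by
      simp only [form_apply, mul_comm]
    exact h u v
  pos y v hv := by
    have h (v : EuclideanSpace ℝ (Fin (m + 2))) (hv : v ≠ 0) : 0 < form y v v :=
      (real_inner_self_pos.2 hv).trans_le (inner_self_le_form y v)
    exact h v hv
  isVonNBounded y := by
    have h : Bornology.IsVonNBounded ℝ
        {v : EuclideanSpace ℝ (Fin (m + 2)) | form y v v < 1} := by
      refine Bornology.IsVonNBounded.subset ?_ (NormedSpace.isVonNBounded_ball ℝ _ 1)
      intro v hv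
      have h := (inner_self_le_form y v).trans_lt hv
      rw [real_inner_self_eq_norm_sq] at h
      rw [mem_ball_zero_iff]
      nlinarith [norm_nonneg v]
    exact h
  contMDiff := by
    intro x
    rw [Bundle.contMDiffAt_section]
    have h := contDiff_form (m := m).contMDiff x
    -- The only chart is the identity, so the section read in the trivialization is `form` itself.
    convert! h using 1
    ext y v w
    simp [hom_trivializationAt_apply, ContinuousLinearMap.inCoordinates]
    rw [Bundle.Trivialization.linearMapAt_apply, if_pos (by
      simp only [hom_trivializationAt_baseSet]
      exact ⟨Set.mem_univ y, trivial⟩)]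
    simp [hom_trivializationAt_apply, ContinuousLinearMap.inCoordinates]
    rfl

lemma metric_inner (y : EuclideanSpace ℝ (Fin (m + 2))) (u v : TangentSpace (𝓡 (m + 2)) y) :
    (metric m).inner y u v = form y (Riem.comp y u) (Riem.comp y v) := rfl

/-! ### Metric matrix and Christoffel symbols -/

lemma extChartAt_eq_id (p : EuclideanSpace ℝ (Fin (m + 2))) :
    (extChartAt (𝓡 (m + 2)) p : EuclideanSpace ℝ (Fin (m + 2)) → _) = id := rfl

lemma coordField_eq (p y : EuclideanSpace ℝ (Fin (m + 2))) (i : Fin (m + 2)) :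
    Riem.coordField p y i = EuclideanSpace.single i (1 : ℝ) := by
  have h : mfderiv 𝓘(ℝ, EuclideanSpace ℝ (Fin (m + 2))) (𝓡 (m + 2))
      (id : EuclideanSpace ℝ (Fin (m + 2)) → EuclideanSpace ℝ (Fin (m + 2))) y
      (EuclideanSpace.single i (1 : ℝ)) = EuclideanSpace.single i (1 : ℝ) := by
    rw [mfderiv_id]
    rfl
  exact h

lemma eq_zero_or_eq_one_or_exists_succ_succ (i : Fin (m + 2)) :
    i = 0 ∨ i = 1 ∨ ∃ j : Fin m, i = j.succ.succ := by
  refine Fin.cases (Or.inl rfl) (fun i => ?_) i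
  exact Fin.cases (Or.inr (Or.inl rfl)) (fun j => Or.inr (Or.inr ⟨j, rfl⟩)) i

@[simp] lemma succ_succ_ne_one (j : Fin m) : j.succ.succ ≠ 1 := by
  rw [← Fin.succ_zero_eq_one, Ne, Fin.succ_inj]
  exact Fin.succ_ne_zero j

@[simp] lemma one_ne_succ_succ (j : Fin m) : 1 ≠ j.succ.succ := (succ_succ_ne_one j).symm

@[simp] lemma zero_ne_succ_succ (j : Fin m) : 0 ≠ j.succ.succ := (Fin.succ_ne_zero _).symm

/-- The indicator function of `{0, 1}`. -/
def planar (i : Fin (m + 2)) : ℝ := if i = 0 ∨ i = 1 then 1 else 0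

@[simp] lemma planar_zero : planar (0 : Fin (m + 2)) = 1 := by simp [planar]

@[simp] lemma planar_one : planar (1 : Fin (m + 2)) = 1 := by simp [planar]

@[simp] lemma planar_succ_succ (j : Fin m) : planar j.succ.succ = 0 := by simp [planar]

/-- Writing `cosh²` as `1 + sinh²` lets one diagonal formula cover the surface and the flat
directions. -/
lemma gram_apply (p y : EuclideanSpace ℝ (Fin (m + 2))) (i j : Fin (m + 2)) :
    Riem.gram (metric m) p y i j =
      if i = j then 1 + planar i * sinh (y 0) ^ 2 else 0 := by
  have h : Riem.gram (metric m) p y i j =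
      form y (EuclideanSpace.single i 1) (EuclideanSpace.single j 1) := by
    rw [← coordField_eq p y i, ← coordField_eq p y j]
    rfl
  rw [h, form_apply, cosh_sq]
  rcases eq_zero_or_eq_one_or_exists_succ_succ i with rfl | rfl | ⟨i, rfl⟩ <;>
  rcases eq_zero_or_eq_one_or_exists_succ_succ j with rfl | rfl | ⟨j, rfl⟩ <;>
  simp [add_comm, eq_comm]

lemma inv_gram_apply (p y : EuclideanSpace ℝ (Fin (m + 2))) (i j : Fin (m + 2)) :
    (Riem.gram (metric m) p y)⁻¹ i j =
      if i = j then (1 + planar i * sinh (y 0) ^ 2)⁻¹ else 0 := by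
  have h : Riem.gram (metric m) p y =
      Matrix.diagonal fun i => 1 + planar i * sinh (y 0) ^ 2 := by
    ext i j
    rw [gram_apply, Matrix.diagonal_apply]
  have h' : Riem.gram (metric m) p y *
      Matrix.diagonal (fun i => (1 + planar i * sinh (y 0) ^ 2)⁻¹) = 1 := by
    rw [h, Matrix.diagonal_mul_diagonal, ← Matrix.diagonal_one]
    congr 1
    ext i
    refine mul_inv_cancel₀ (ne_of_gt ?_)
    unfold planar
    split_ifs <;> positivity
  rw [Matrix.inv_eq_right_inv h', Matrix.diagonal_apply]

lemma hasFDerivAt_coord (i : Fin (m + 2)) (y : EuclideanSpace ℝ (Fin (m + 2))) :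
    HasFDerivAt (fun z : EuclideanSpace ℝ (Fin (m + 2)) => z i)
      (EuclideanSpace.proj (𝕜 := ℝ) i : EuclideanSpace ℝ (Fin (m + 2)) →L[ℝ] ℝ) y :=
  (EuclideanSpace.proj (𝕜 := ℝ) i : EuclideanSpace ℝ (Fin (m + 2)) →L[ℝ] ℝ).hasFDerivAt

lemma fderiv_comp_coord_zero {φ : ℝ → ℝ} {φ' : ℝ} {y : EuclideanSpace ℝ (Fin (m + 2))}
    (h : HasDerivAt φ φ' (y 0)) (v : EuclideanSpace ℝ (Fin (m + 2))) :
    fderiv ℝ (fun z : EuclideanSpace ℝ (Fin (m + 2)) => φ (z 0)) y v = φ' * v 0 := by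
  have h' : HasFDerivAt (fun z : EuclideanSpace ℝ (Fin (m + 2)) => φ (z 0)) _ y :=
    h.comp_hasFDerivAt y (hasFDerivAt_coord 0 y)
  rw [h'.fderiv]
  simp

lemma partialDeriv_comp_coord_zero {φ : ℝ → ℝ} {φ' : ℝ} {y : EuclideanSpace ℝ (Fin (m + 2))}
    (h : HasDerivAt φ φ' (y 0)) (k : Fin (m + 2)) :
    Riem.partialDeriv (fun z => φ (z 0)) k y = if k = 0 then φ' else 0 := by
  rw [Riem.partialDeriv, fderiv_comp_coord_zero h]
  simp [eq_comm]

lemma partialDeriv_gram (p y : EuclideanSpace ℝ (Fin (m + 2))) (i j k : Fin (m + 2)) :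
    Riem.partialDeriv (fun z => Riem.gram (metric m) p z i j) k y =
      if k = 0 then (if i = j then planar i * (2 * sinh (y 0) * cosh (y 0)) else 0) else 0 := by
  simp only [gram_apply]
  refine partialDeriv_comp_coord_zero
    (φ := fun t => if i = j then 1 + planar i * sinh t ^ 2 else 0) ?_ k
  split_ifs
  · convert! (((hasDerivAt_sinh (y 0)).pow 2).const_mul (planar i)).const_add 1 using 1
    simp
  · exact hasDerivAt_const _ _

/-- The Christoffel symbols `Γˡᵢⱼ` divided by `tanh y₀`. -/
def christoffelConst (l i j : Fin (m + 2)) : ℝ :=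
  (if i = 0 ∧ j = l then planar l else 0) + (if j = 0 ∧ i = l then planar l else 0) -
    if l = 0 ∧ i = j then planar i else 0

/-- All symbols come from half the logarithmic derivative of the conformal factor `cosh² y₀`, which
is `tanh y₀`; the remaining factor is constant. -/
lemma christoffel_eq (p y : EuclideanSpace ℝ (Fin (m + 2))) (l i j : Fin (m + 2)) :
    Riem.christoffel (metric m) p l i j y = tanh (y 0) * christoffelConst l i j := by
  have hc := (cosh_pos (y 0)).ne'
  simp only [Riem.christoffel, inv_gram_apply, partialDeriv_gram, ite_mul, zero_mul,
    Finset.sum_ite_eq, Finset.mem_univ, if_true, christoffelConst]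
  have hc' : 1 + sinh (y 0) ^ 2 = cosh (y 0) ^ 2 := by rw [cosh_sq]; ring
  rw [tanh_eq_sinh_div_cosh]
  rcases eq_zero_or_eq_one_or_exists_succ_succ l with rfl | rfl | ⟨l, rfl⟩ <;>
  rcases eq_zero_or_eq_one_or_exists_succ_succ i with rfl | rfl | ⟨i, rfl⟩ <;>
  rcases eq_zero_or_eq_one_or_exists_succ_succ j with rfl | rfl | ⟨j, rfl⟩ <;>
  simp [hc'] <;> field_simp

lemma partialDeriv_christoffel (p y : EuclideanSpace ℝ (Fin (m + 2))) (l i j k : Fin (m + 2)) :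
    Riem.partialDeriv (Riem.christoffel (metric m) p l i j) k y =
      if k = 0 then (1 / cosh (y 0) ^ 2) * christoffelConst l i j else 0 := by
  rw [show Riem.christoffel (metric m) p l i j = fun z => tanh (z 0) * christoffelConst l i j from
    funext fun z => christoffel_eq p z l i j]
  refine partialDeriv_comp_coord_zero (φ := fun t => tanh t * christoffelConst l i j) ?_ k
  have h := ((hasDerivAt_sinh (y 0)).div (hasDerivAt_cosh (y 0)) (cosh_pos (y 0)).ne').mul_const
    (christoffelConst l i j)
  convert! h using 1
  · ext t
    rw [tanh_eq_sinh_div_cosh]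
    rfl
  · rw [← sq, ← sq, cosh_sq (y 0)]
    ring

@[simp] lemma christoffelConst_succ_succ (n : Fin m) (i j : Fin (m + 2)) :
    christoffelConst n.succ.succ i j = 0 := by
  simp [christoffelConst]

/-- For fixed `i`, read `christoffelConst l i n` as a matrix in `(l, n)`: it is the projection to
the surface plane for `i = 0`, a quarter turn of that plane for `i = 1`, and zero otherwise. These
matrices commute. -/
lemma sum_christoffelConst (i j k l : Fin (m + 2)) :
    ∑ n, (christoffelConst l i n * christoffelConst n j k -
      christoffelConst l j n * christoffelConst n i k) = 0 := by
  rw [Fin.sum_univ_succ, Fin.sum_univ_succ]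
  simp only [christoffelConst_succ_succ, mul_zero, sub_zero, Finset.sum_const_zero, add_zero,
    Fin.succ_zero_eq_one]
  rcases eq_zero_or_eq_one_or_exists_succ_succ i with rfl | rfl | ⟨i, rfl⟩ <;>
  rcases eq_zero_or_eq_one_or_exists_succ_succ j with rfl | rfl | ⟨j, rfl⟩ <;>
  rcases eq_zero_or_eq_one_or_exists_succ_succ k with rfl | rfl | ⟨k, rfl⟩ <;>
  rcases eq_zero_or_eq_one_or_exists_succ_succ l with rfl | rfl | ⟨l, rfl⟩ <;>
  simp [christoffelConst]

/-! ### Curvature -/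

lemma curvatureCoeff_eq (p : EuclideanSpace ℝ (Fin (m + 2))) (i j k l : Fin (m + 2)) :
    Riem.curvatureCoeff (metric m) p i j k l =
      (1 / cosh (p 0) ^ 2) * ((if i = 0 then christoffelConst l j k else 0) -
        if j = 0 then christoffelConst l i k else 0) := by
  have h := sum_christoffelConst i j k l
  have h' (a b c d : ℝ) (t : ℝ) : t * a * (t * b) - t * c * (t * d) = t ^ 2 * (a * b - c * d) := by
    ring
  simp only [Riem.curvatureCoeff, extChartAt_eq_id, id, partialDeriv_christoffel]
  simp only [christoffel_eq, h', ← Finset.mul_sum, h, mul_zero, add_zero]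
  rw [mul_sub, mul_ite, mul_ite, mul_zero]

lemma comp_curvature (p : EuclideanSpace ℝ (Fin (m + 2))) (u v w : TangentSpace (𝓡 (m + 2)) p)
    (l : Fin (m + 2)) :
    Riem.comp p (Riem.curvature (metric m) p u v w) l =
      -(1 / cosh (p 0) ^ 2) * (Riem.comp p u 0 * Riem.comp p v 1 - Riem.comp p u 1 * Riem.comp p v 0) *
        ((if l = 0 then Riem.comp p w 1 else 0) - if l = 1 then Riem.comp p w 0 else 0) := by
  have h : Riem.comp p (Riem.curvature (metric m) p u v w) l = ∑ i, ∑ j, ∑ k,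
      Riem.comp p u i * Riem.comp p v j * Riem.comp p w k *
        Riem.curvatureCoeff (metric m) p i j k l := rfl
  -- The coefficient is a multiple of the area form of the surface plane in `(i, j)` times the same
  -- form in `(l, k)`.
  have h' (i j k : Fin (m + 2)) : Riem.curvatureCoeff (metric m) p i j k l =
      -(1 / cosh (p 0) ^ 2) * (((if i = 0 then 1 else 0) * (if j = 1 then 1 else 0) -
        (if i = 1 then 1 else 0) * if j = 0 then 1 else 0) *
      ((if l = 0 then 1 else 0) * (if k = 1 then 1 else 0) -
        (if l = 1 then 1 else 0) * if k = 0 then 1 else 0)) := by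
    rw [curvatureCoeff_eq]
    rcases eq_zero_or_eq_one_or_exists_succ_succ l with rfl | rfl | ⟨l, rfl⟩
    rotate_left 2
    · simp
    all_goals
      rcases eq_zero_or_eq_one_or_exists_succ_succ i with rfl | rfl | ⟨i, rfl⟩ <;>
      rcases eq_zero_or_eq_one_or_exists_succ_succ j with rfl | rfl | ⟨j, rfl⟩ <;>
      simp [christoffelConst, eq_comm] <;>
      split_ifs <;> simp
  generalize Riem.comp p (Riem.curvature (metric m) p u v w) = r at h ⊢
  generalize Riem.comp p u = u' at *
  generalize Riem.comp p v = v' at *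
  generalize Riem.comp p w = w' at *
  rw [h]
  simp only [h']
  simp only [mul_sub, sub_mul, Finset.sum_sub_distrib, mul_ite, mul_one, mul_zero,
    Finset.sum_ite_eq', Finset.mem_univ, if_true]
  rcases eq_zero_or_eq_one_or_exists_succ_succ l with rfl | rfl | ⟨l, rfl⟩ <;>
    simp <;> ring

/-- The factor `cosh²` of the metric cancels the `1 / cosh²` of the curvature, leaving minus the
square of a 2×2 minor. -/
lemma sectionalCurvature_of_orthonormal (p : EuclideanSpace ℝ (Fin (m + 2)))
    {u v : TangentSpace (𝓡 (m + 2)) p} (hu : (metric m).inner p u u = 1)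
    (hv : (metric m).inner p v v = 1) (huv : (metric m).inner p u v = 0) :
    Riem.sectionalCurvature (metric m) p u v =
      -(Riem.comp p u 0 * Riem.comp p v 1 - Riem.comp p u 1 * Riem.comp p v 0) ^ 2 := by
  have hc := (cosh_pos (p 0)).ne'
  rw [Riem.sectionalCurvature, hu, hv, huv, metric_inner, form_apply]
  simp only [comp_curvature]
  simp
  field_simp
  ring

/-- Lagrange's identity: the sum over all ordered pairs counts each unordered pair twice, and its
diagonal vanishes. -/
lemma sum_sum_lt_eq {N : ℕ} (x y : Fin N → ℝ) :
    (∑ a, ∑ b, if a < b then -(x a * y b - y a * x b) ^ 2 else 0) =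
      (∑ a, x a * y a) ^ 2 - (∑ a, x a * x a) * ∑ a, y a * y a := by
  have h1 : ∑ a, ∑ b, -(x a * y b - y a * x b) ^ 2 =
      2 * ((∑ a, x a * y a) ^ 2 - (∑ a, x a * x a) * ∑ a, y a * y a) := by
    have h (a b : Fin N) : -(x a * y b - y a * x b) ^ 2 =
        2 * ((x a * y a) * (x b * y b)) - (x a * x a) * (y b * y b) - (y a * y a) * (x b * x b) := by
      ring
    simp only [h, Finset.sum_sub_distrib, ← Finset.mul_sum, ← Finset.sum_mul]
    ring
  have h2 : ∑ a, ∑ b, -(x a * y b - y a * x b) ^ 2 =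
      (∑ a, ∑ b, if a < b then -(x a * y b - y a * x b) ^ 2 else 0) +
        ∑ a, ∑ b, if b < a then -(x b * y a - y b * x a) ^ 2 else 0 := by
    rw [← Finset.sum_add_distrib]
    refine Finset.sum_congr rfl fun a _ => ?_
    rw [← Finset.sum_add_distrib]
    refine Finset.sum_congr rfl fun b _ => ?_
    rcases lt_trichotomy a b with h | rfl | h
    · simp [h, h.not_gt]
    · simp [mul_comm]
    · simp only [h, h.not_gt, if_true, if_false]
      ring
  have h3 : (∑ a, ∑ b, if b < a then -(x b * y a - y b * x a) ^ 2 else 0) =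
      ∑ a, ∑ b, if a < b then -(x a * y b - y a * x b) ^ 2 else 0 := Finset.sum_comm
  linarith

/-! ### Scalar curvature of subspaces and the invariant `δ(2)` -/

/-- By Lagrange's identity `τ(L)` is minus the Gram determinant of the two lists of surface
coordinates of an orthonormal basis. The index `r` stands for the rank so that later sums run over a
literal `Fin 2` or `Fin (m + 2)`. -/
lemma exists_scalarCurvatureOf_eq (p : EuclideanSpace ℝ (Fin (m + 2)))
    (L : Submodule ℝ (TangentSpace (𝓡 (m + 2)) p)) {r : ℕ} (hL : Module.finrank ℝ L = r) :
    ∃ e : Fin r → TangentSpace (𝓡 (m + 2)) p, Riem.IsOrthonormalBasisOf (metric m) p L e ∧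
      Riem.scalarCurvatureOf (metric m) p L =
        (∑ a, Riem.comp p (e a) 0 * Riem.comp p (e a) 1) ^ 2 -
          (∑ a, Riem.comp p (e a) 0 * Riem.comp p (e a) 0) *
            ∑ a, Riem.comp p (e a) 1 * Riem.comp p (e a) 1 := by
  subst hL
  have h := (Riem.exists_isOrthonormalBasisOf (metric m) p L).choose_spec
  refine ⟨_, h, ?_⟩
  rw [← sum_sum_lt_eq, Riem.scalarCurvatureOf]
  refine Finset.sum_congr rfl fun a _ => Finset.sum_congr rfl fun b _ => ?_
  split_ifs with hab
  · refine sectionalCurvature_of_orthonormal p ?_ ?_ ?_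
    · exact (h.1 a a).trans (if_pos rfl)
    · exact (h.1 b b).trans (if_pos rfl)
    · exact (h.1 a b).trans (if_neg hab.ne)
  · rfl

lemma finrank_tangentSpace (p : EuclideanSpace ℝ (Fin (m + 2))) :
    Module.finrank ℝ (⊤ : Submodule ℝ (TangentSpace (𝓡 (m + 2)) p)) = m + 2 := by
  rw [finrank_top]
  exact finrank_euclideanSpace_fin

/-- Completeness of an orthonormal basis of the whole tangent space, in the first two
coordinates. -/
lemma sum_comp_mul_comp {p : EuclideanSpace ℝ (Fin (m + 2))} {N : ℕ} (hN : N = m + 2)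
    {e : Fin N → TangentSpace (𝓡 (m + 2)) p}
    (he : ∀ a b, (metric m).inner p (e a) (e b) = if a = b then 1 else 0)
    {i j : Fin (m + 2)} (hi : i = 0 ∨ i = 1) (hj : j = 0 ∨ j = 1) :
    ∑ a, Riem.comp p (e a) i * Riem.comp p (e a) j =
      if i = j then 1 / cosh (p 0) ^ 2 else 0 := by
  subst hN
  have hc := (cosh_pos (p 0)).ne'
  -- Rescaling the surface coordinates by `cosh` makes the rows of `A` Euclidean orthonormal; `A` is
  -- square, so its columns are orthonormal too.
  let s (i : Fin (m + 2)) : ℝ := if i = 0 ∨ i = 1 then cosh (p 0) else 1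
  let A : Matrix (Fin (m + 2)) (Fin (m + 2)) ℝ := Matrix.of fun a i => s i * Riem.comp p (e a) i
  have h : A * A.transpose = 1 := by
    ext a b
    rw [Matrix.mul_apply, Matrix.one_apply, ← he, metric_inner, form_apply, Fin.sum_univ_succ,
      Fin.sum_univ_succ]
    simp [A, s]
    ring
  have h' : (A.transpose * A) i j = (1 : Matrix _ _ ℝ) i j := by rw [mul_eq_one_comm.mp h]
  have hsi : s i = cosh (p 0) := if_pos hi
  have hsj : s j = cosh (p 0) := if_pos hj
  simp only [Matrix.mul_apply, Matrix.transpose_apply, Matrix.one_apply, A, Matrix.of_apply, hsi, hsj]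
    at h'
  have h2 : cosh (p 0) ^ 2 * ∑ a, Riem.comp p (e a) i * Riem.comp p (e a) j =
      if i = j then 1 else 0 := by
    rw [← h', Finset.mul_sum]
    refine Finset.sum_congr rfl fun a _ => ?_
    ring
  split_ifs at h2 ⊢
  · field_simp
    linarith
  · simpa [hc] using h2

lemma scalarCurvature_eq (p : EuclideanSpace ℝ (Fin (m + 2))) :
    Riem.scalarCurvature (metric m) p = -(1 / cosh (p 0) ^ 2) ^ 2 := by
  obtain ⟨e, he, h⟩ := exists_scalarCurvatureOf_eq p ⊤ (finrank_tangentSpace p)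
  rw [Riem.scalarCurvature, h, sum_comp_mul_comp rfl he.1 (.inl rfl) (.inr rfl),
    sum_comp_mul_comp rfl he.1 (.inl rfl) (.inl rfl), sum_comp_mul_comp rfl he.1 (.inr rfl) (.inr rfl)]
  simp
  ring

/-- Hadamard's inequality: `-τ(L)` is the squared determinant of the surface parts of two unit
vectors, and each part has squared Euclidean length at most `1 / cosh²`. -/
lemma le_scalarCurvatureOf (p : EuclideanSpace ℝ (Fin (m + 2)))
    (L : Submodule ℝ (TangentSpace (𝓡 (m + 2)) p)) (hL : Module.finrank ℝ L = 2) :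
    -(1 / cosh (p 0) ^ 2) ^ 2 ≤ Riem.scalarCurvatureOf (metric m) p L := by
  obtain ⟨e, he, h⟩ := exists_scalarCurvatureOf_eq p L hL
  have hc := cosh_pos (p 0)
  have hb (a : Fin 2) : Riem.comp p (e a) 0 ^ 2 + Riem.comp p (e a) 1 ^ 2 ≤ 1 / cosh (p 0) ^ 2 := by
    have h1 := he.1 a a
    rw [metric_inner, form_apply, if_pos rfl] at h1
    have h2 : 0 ≤ ∑ j : Fin m, Riem.comp p (e a) j.succ.succ * Riem.comp p (e a) j.succ.succ :=
      Finset.sum_nonneg fun j _ => mul_self_nonneg _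
    rw [le_div_iff₀ (by positivity)]
    linarith
  have h3 := mul_le_mul (hb 0) (hb 1) (by positivity) (by positivity)
  rw [h]
  simp only [Fin.sum_univ_two]
  nlinarith [sq_nonneg (Riem.comp p (e 0) 0 * Riem.comp p (e 1) 0 +
    Riem.comp p (e 0) 1 * Riem.comp p (e 1) 1)]

/-- The plane spanned by the first two coordinate vectors. -/
noncomputable def coordPlane (m : ℕ) : Submodule ℝ (EuclideanSpace ℝ (Fin (m + 2))) :=
  Submodule.span ℝ (Set.range ![EuclideanSpace.single 0 (1 : ℝ), EuclideanSpace.single 1 (1 : ℝ)])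

lemma finrank_coordPlane : Module.finrank ℝ (coordPlane m) = 2 := by
  have h : LinearIndependent ℝ ![EuclideanSpace.single (0 : Fin (m + 2)) (1 : ℝ),
      EuclideanSpace.single 1 (1 : ℝ)] := by
    rw [LinearIndependent.pair_iff]
    intro s t hst
    have h0 := congrArg (fun v : EuclideanSpace ℝ (Fin (m + 2)) => v 0) hst
    have h1 := congrArg (fun v : EuclideanSpace ℝ (Fin (m + 2)) => v 1) hst
    simp at h0 h1
    exact ⟨h0, h1⟩
  exact (finrank_span_eq_card h).trans (Fintype.card_fin 2)

lemma apply_succ_succ_of_mem_coordPlane {v : EuclideanSpace ℝ (Fin (m + 2))}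
    (hv : v ∈ coordPlane m) (j : Fin m) : v j.succ.succ = 0 := by
  induction hv using Submodule.span_induction with
  | mem x hx =>
    obtain ⟨a, rfl⟩ := hx
    fin_cases a <;> simp
  | zero => rfl
  | add x y _ _ hx hy => simp [hx, hy]
  | smul t x _ hx => simp [hx]

lemma scalarCurvatureOf_coordPlane (p : EuclideanSpace ℝ (Fin (m + 2)))
    (L : Submodule ℝ (TangentSpace (𝓡 (m + 2)) p)) (hL : L = coordPlane m) :
    Riem.scalarCurvatureOf (metric m) p L = -(1 / cosh (p 0) ^ 2) ^ 2 := by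
  have hr : Module.finrank ℝ L = 2 := by
    subst hL
    exact finrank_coordPlane
  obtain ⟨e, he, h⟩ := exists_scalarCurvatureOf_eq p L hr
  have hc := (cosh_pos (p 0)).ne'
  have hz (a : Fin 2) (j : Fin m) : Riem.comp p (e a) j.succ.succ = 0 := by
    have ha : e a ∈ L := he.2 ▸ Submodule.subset_span ⟨a, rfl⟩
    rw [hL] at ha
    exact apply_succ_succ_of_mem_coordPlane ha j
  have hf (a b : Fin 2) : Riem.comp p (e a) 0 * Riem.comp p (e b) 0 +
      Riem.comp p (e a) 1 * Riem.comp p (e b) 1 =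
        (1 / cosh (p 0) ^ 2) * if a = b then 1 else 0 := by
    rw [← he.1 a b, metric_inner, form_apply]
    simp only [hz, mul_zero, Finset.sum_const_zero, add_zero]
    field_simp
  have h00 := hf 0 0
  have h11 := hf 1 1
  have h01 := hf 0 1
  simp only [if_true, mul_one, zero_ne_one, if_false, mul_zero] at h00 h11 h01
  rw [h]
  simp only [Fin.sum_univ_two]
  -- The squared determinant equals the Gram determinant of the two planar vectors, whose Gram
  -- matrix is `1 / cosh²` times the identity.
  linear_combination -(1 / cosh (p 0) ^ 2) * h00 - (Riem.comp p (e 0) 0 * Riem.comp p (e 0) 0 +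
      Riem.comp p (e 0) 1 * Riem.comp p (e 0) 1) * h11 + (Riem.comp p (e 0) 0 * Riem.comp p (e 1) 0 +
      Riem.comp p (e 0) 1 * Riem.comp p (e 1) 1) * h01

/-- The coordinate plane attains the lower bound of `le_scalarCurvatureOf`, and this minimum equals
`τ(p)`. With a single subspace, orthogonality is vacuous. -/
lemma deltaInvariant_two (p : EuclideanSpace ℝ (Fin (m + 2))) :
    Riem.deltaInvariant (metric m) (fun _ : Fin 1 => 2) p = 0 := by
  have h : IsLeast {t : ℝ | ∃ L : Fin 1 → Submodule ℝ (TangentSpace (𝓡 (m + 2)) p),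
      Riem.IsOrthogonalFamily (metric m) p (fun _ => 2) L ∧
        t = ∑ j, Riem.scalarCurvatureOf (metric m) p (L j)} (-(1 / cosh (p 0) ^ 2) ^ 2) := by
    refine ⟨⟨fun _ => coordPlane m, ⟨fun _ => finrank_coordPlane, fun i j hij => ?_⟩, ?_⟩, ?_⟩
    · exact absurd (Subsingleton.elim i j) hij
    · rw [Fin.sum_univ_one]
      exact (scalarCurvatureOf_coordPlane p _ rfl).symm
    · rintro t ⟨L, hL, rfl⟩
      rw [Fin.sum_univ_one]
      exact le_scalarCurvatureOf p _ (hL.1 0)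
  rw [Riem.deltaInvariant, h.csInf_eq, scalarCurvature_eq, sub_self]

/-! ### Cylinders over surfaces with separated coordinates -/

/-- The linear map placing a vector of `ℝ³` and the last `m` coordinates of a vector of `ℝ^(m+2)`
side by side in `ℝ^(m+3)`. -/
noncomputable def assemble (m : ℕ) : (Fin 3 → ℝ) × EuclideanSpace ℝ (Fin (m + 2)) →L[ℝ]
    EuclideanSpace ℝ (Fin (m + 2 + 1)) :=
  LinearMap.toContinuousLinearMap
    { toFun x := WithLp.toLp 2 (Matrix.vecCons (x.1 0) (Matrix.vecCons (x.1 1)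
        (Matrix.vecCons (x.1 2) fun j : Fin m => x.2 j.succ.succ)))
      map_add' x y := by
        ext i
        refine Fin.cases rfl (fun i => Fin.cases rfl (fun i => Fin.cases rfl (fun i => ?_) i) i) i
        rfl
      map_smul' t x := by
        ext i
        refine Fin.cases rfl (fun i => Fin.cases rfl (fun i => Fin.cases rfl (fun i => ?_) i) i) i
        rfl }

lemma assemble_apply (x : (Fin 3 → ℝ) × EuclideanSpace ℝ (Fin (m + 2))) :
    assemble m x = WithLp.toLp 2 (Matrix.vecCons (x.1 0) (Matrix.vecCons (x.1 1)
        (Matrix.vecCons (x.1 2) fun j : Fin m => x.2 j.succ.succ))) := rfl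

lemma inner_assemble (a b : Fin 3 → ℝ) (x y : EuclideanSpace ℝ (Fin (m + 2))) :
    inner ℝ (assemble m (a, x)) (assemble m (b, y)) =
      ∑ k, a k * b k + ∑ j : Fin m, x j.succ.succ * y j.succ.succ := by
  simp only [assemble_apply, PiLp.inner_apply, RCLike.inner_apply, conj_trivial]
  simp [Fin.sum_univ_succ, mul_comm]
  ring

/-- The cylinder over the surface in `ℝ³` whose `k`-th coordinate is `P k u * Q k v`. -/
noncomputable def separatedCylinder (m : ℕ) (P Q : Fin 3 → ℝ → ℝ)
    (y : EuclideanSpace ℝ (Fin (m + 2))) : EuclideanSpace ℝ (Fin (m + 2 + 1)) :=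
  assemble m (fun k => P k (y 0) * Q k (y 1), y)

variable {P Q : Fin 3 → ℝ → ℝ}

lemma contDiff_coord (i : Fin (m + 2)) :
    ContDiff ℝ ∞ fun y : EuclideanSpace ℝ (Fin (m + 2)) => y i :=
  (EuclideanSpace.proj (𝕜 := ℝ) i : EuclideanSpace ℝ (Fin (m + 2)) →L[ℝ] ℝ).contDiff

lemma contDiff_separatedCylinder (hP : ∀ k, ContDiff ℝ ∞ (P k)) (hQ : ∀ k, ContDiff ℝ ∞ (Q k)) :
    ContDiff ℝ ∞ (separatedCylinder m P Q) := by
  refine (assemble m).contDiff.comp (ContDiff.prodMk (contDiff_pi.mpr fun k => ?_) contDiff_id)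
  exact ((hP k).comp (contDiff_coord 0)).mul ((hQ k).comp (contDiff_coord 1))

lemma hasFDerivAt_separated {p q : ℝ → ℝ} (y : EuclideanSpace ℝ (Fin (m + 2)))
    (hp : DifferentiableAt ℝ p (y 0)) (hq : DifferentiableAt ℝ q (y 1)) :
    HasFDerivAt (fun y : EuclideanSpace ℝ (Fin (m + 2)) => p (y 0) * q (y 1))
      (p (y 0) • deriv q (y 1) • (EuclideanSpace.proj (𝕜 := ℝ) (1 : Fin (m + 2)) :
          EuclideanSpace ℝ (Fin (m + 2)) →L[ℝ] ℝ) +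
        q (y 1) • deriv p (y 0) • (EuclideanSpace.proj (𝕜 := ℝ) (0 : Fin (m + 2)) :
          EuclideanSpace ℝ (Fin (m + 2)) →L[ℝ] ℝ)) y :=
  (hp.hasDerivAt.comp_hasFDerivAt y (hasFDerivAt_coord 0 y)).mul
    (hq.hasDerivAt.comp_hasFDerivAt y (hasFDerivAt_coord 1 y))

lemma fderiv_separatedCylinder (hP : ∀ k, Differentiable ℝ (P k))
    (hQ : ∀ k, Differentiable ℝ (Q k)) (y v : EuclideanSpace ℝ (Fin (m + 2))) :
    fderiv ℝ (separatedCylinder m P Q) y v =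
      assemble m (fun k => P k (y 0) * (deriv (Q k) (y 1) * v 1) +
        Q k (y 1) * (deriv (P k) (y 0) * v 0), v) := by
  have h := (assemble m).hasFDerivAt.comp y (HasFDerivAt.prodMk (hasFDerivAt_pi.mpr fun k =>
    hasFDerivAt_separated y (hP k (y 0)) (hQ k (y 1))) (hasFDerivAt_id y))
  have h' : HasFDerivAt (separatedCylinder m P Q) _ y := h
  rw [h'.fderiv]
  rfl

/-- Only the diagonal values enter the trace of `h`. The flat factor is embedded linearly and
contributes zero. -/
lemma fderiv_fderiv_separatedCylinder (hP : ∀ k, ContDiff ℝ ∞ (P k))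
    (hQ : ∀ k, ContDiff ℝ ∞ (Q k)) (y v : EuclideanSpace ℝ (Fin (m + 2))) :
    fderiv ℝ (fun z => fderiv ℝ (separatedCylinder m P Q) z v) y v =
      assemble m (fun k => P k (y 0) * deriv (deriv (Q k)) (y 1) * (v 1 * v 1) +
        2 * (deriv (P k) (y 0) * deriv (Q k) (y 1)) * (v 0 * v 1) +
        deriv (deriv (P k)) (y 0) * Q k (y 1) * (v 0 * v 0), 0) := by
  have hP1 (k) : Differentiable ℝ (P k) := (hP k).differentiable (by simp)
  have hQ1 (k) : Differentiable ℝ (Q k) := (hQ k).differentiable (by simp)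
  have hP2 (k) : Differentiable ℝ (deriv (P k)) :=
    ((contDiff_infty_iff_deriv.mp (hP k)).2).differentiable (by simp)
  have hQ2 (k) : Differentiable ℝ (deriv (Q k)) :=
    ((contDiff_infty_iff_deriv.mp (hQ k)).2).differentiable (by simp)
  have h1 (k) := ((hasFDerivAt_separated y (hP1 k (y 0)) (hQ2 k (y 1))).mul_const (v 1)).add
    ((hasFDerivAt_separated y (hP2 k (y 0)) (hQ1 k (y 1))).mul_const (v 0))
  have h := (assemble m).hasFDerivAt.comp y
    ((hasFDerivAt_pi.mpr h1).prodMk (hasFDerivAt_const (𝕜 := ℝ) v y))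
  have hf : (fun z => fderiv ℝ (separatedCylinder m P Q) z v) = fun z => assemble m
      (fun k => P k (z 0) * deriv (Q k) (z 1) * v 1 + deriv (P k) (z 0) * Q k (z 1) * v 0, v) := by
    refine funext fun z => (fderiv_separatedCylinder hP1 hQ1 z v).trans ?_
    exact congrArg (assemble m) (Prod.ext (funext fun k => by ring) rfl)
  rw [hf]
  refine (congrArg (fun D => D v) h.fderiv).trans ?_
  refine congrArg (assemble m) (Prod.ext (funext fun k => ?_) rfl)
  simp
  ring

/-- The hypotheses `h00`, `h11`, `h01` are `E = G = cosh²` and `F = 0` for the surface in `ℝ³`. -/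
lemma isIsometricImmersion_separatedCylinder (hP : ∀ k, ContDiff ℝ ∞ (P k))
    (hQ : ∀ k, ContDiff ℝ ∞ (Q k))
    (h00 : ∀ s t, ∑ k, (deriv (P k) s * Q k t) ^ 2 = cosh s ^ 2)
    (h11 : ∀ s t, ∑ k, (P k s * deriv (Q k) t) ^ 2 = cosh s ^ 2)
    (h01 : ∀ s t, ∑ k, (deriv (P k) s * Q k t) * (P k s * deriv (Q k) t) = 0) :
    Riem.IsIsometricImmersion (metric m) (separatedCylinder m P Q) := by
  refine ⟨(contDiff_separatedCylinder hP hQ).contMDiff, fun p u v => ?_⟩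
  have hd : Riem.differential (n := m + 2) (separatedCylinder m P Q) p =
      fderiv ℝ (separatedCylinder m P Q) p := mfderiv_eq_fderiv
  rw [metric_inner, form_apply, hd,
    fderiv_separatedCylinder (fun k => (hP k).differentiable (by simp))
      (fun k => (hQ k).differentiable (by simp)),
    fderiv_separatedCylinder (fun k => (hP k).differentiable (by simp))
      (fun k => (hQ k).differentiable (by simp)), inner_assemble]
  have h00 := h00 (p 0) (p 1)
  have h11 := h11 (p 0) (p 1)
  have h01 := h01 (p 0) (p 1)
  rw [Fin.sum_univ_three] at h00 h11 h01 ⊢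
  generalize Riem.comp p u = u at *
  generalize Riem.comp p v = v at *
  linear_combination (u 0 * v 0) * h00 + (u 1 * v 1) * h11 + (u 0 * v 1 + u 1 * v 0) * h01

/-- In isothermal coordinates the trace of the second derivative is a multiple of the Laplacian.
Since `h` says that the coordinate functions are harmonic, the trace vanishes even before projection
to the normal space. -/
lemma meanCurvatureVector_separatedCylinder (hP : ∀ k, ContDiff ℝ ∞ (P k))
    (hQ : ∀ k, ContDiff ℝ ∞ (Q k))
    (h : ∀ k s t, deriv (deriv (P k)) s * Q k t + P k s * deriv (deriv (Q k)) t = 0)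
    (p : EuclideanSpace ℝ (Fin (m + 2))) :
    Riem.meanCurvatureVector (metric m) (separatedCylinder m P Q) p = 0 := by
  have he := (Riem.exists_isOrthonormalBasisOf (metric m) p ⊤).choose_spec.1
  change ∀ a b, (metric m).inner p (Riem.orthonormalBasisOf (metric m) p ⊤ a)
    (Riem.orthonormalBasisOf (metric m) p ⊤ b) = _ at he
  have hN := finrank_tangentSpace p
  have h00 := sum_comp_mul_comp hN he (.inl rfl) (.inl rfl)
  have h11 := sum_comp_mul_comp hN he (.inr rfl) (.inr rfl)
  have h01 := sum_comp_mul_comp hN he (.inl rfl) (.inr rfl)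
  have hs : ∀ v : TangentSpace (𝓡 (m + 2)) p,
      Riem.secondFundamentalForm (separatedCylinder m P Q) p v v =
        (LinearMap.range (Riem.differential (n := m + 2)
          (separatedCylinder m P Q) p).toLinearMap)ᗮ.starProjection
        (fderiv ℝ (fun z => fderiv ℝ (separatedCylinder m P Q) z (Riem.comp p v)) p
          (Riem.comp p v)) := fun v => rfl
  simp only [Riem.meanCurvatureVector, hs, fderiv_fderiv_separatedCylinder hP hQ, ← map_sum]
  -- Summed over the basis, the products of coordinates become `1 / cosh²` or `0`, so the mixed
  -- derivative drops out and the two pure ones get equal weight.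
  have hz : ∑ a, ((fun k => P k (p 0) * deriv (deriv (Q k)) (p 1) *
          (Riem.comp p (Riem.orthonormalBasisOf (metric m) p ⊤ a) 1 *
            Riem.comp p (Riem.orthonormalBasisOf (metric m) p ⊤ a) 1) +
        2 * (deriv (P k) (p 0) * deriv (Q k) (p 1)) *
          (Riem.comp p (Riem.orthonormalBasisOf (metric m) p ⊤ a) 0 *
            Riem.comp p (Riem.orthonormalBasisOf (metric m) p ⊤ a) 1) +
        deriv (deriv (P k)) (p 0) * Q k (p 1) *
          (Riem.comp p (Riem.orthonormalBasisOf (metric m) p ⊤ a) 0 *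
            Riem.comp p (Riem.orthonormalBasisOf (metric m) p ⊤ a) 0), 0) :
        (Fin 3 → ℝ) × EuclideanSpace ℝ (Fin (m + 2))) = 0 := by
    refine Prod.ext (funext fun k => ?_) ?_
    · rw [Prod.fst_sum, Finset.sum_apply]
      simp only [Finset.sum_add_distrib, ← Finset.mul_sum, h00, h11, h01]
      simp
      linear_combination (cosh (p 0) ^ 2)⁻¹ * h k (p 0) (p 1)
    · simp [Prod.snd_sum]
  rw [hz, map_zero, map_zero, smul_zero]

/-- The tuple is `(2)`, admissible because `m ≥ 1` means `2 < n`; both sides of the equality are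
zero. -/
lemma isIdeal_separatedCylinder (hm : 1 ≤ m) (hP : ∀ k, ContDiff ℝ ∞ (P k))
    (hQ : ∀ k, ContDiff ℝ ∞ (Q k))
    (h00 : ∀ s t, ∑ k, (deriv (P k) s * Q k t) ^ 2 = cosh s ^ 2)
    (h11 : ∀ s t, ∑ k, (P k s * deriv (Q k) t) ^ 2 = cosh s ^ 2)
    (h01 : ∀ s t, ∑ k, (deriv (P k) s * Q k t) * (P k s * deriv (Q k) t) = 0)
    (h : ∀ k s t, deriv (deriv (P k)) s * Q k t + P k s * deriv (deriv (Q k)) t = 0) :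
    Riem.IsIdeal (metric m) (separatedCylinder m P Q) := by
  refine ⟨1, fun _ => 2, ⟨le_rfl, fun _ => ⟨le_rfl,
      Nat.lt_of_lt_of_le (by norm_num) (Nat.add_le_add_right hm 2)⟩, by simp⟩,
    isIsometricImmersion_separatedCylinder hP hQ h00 h11 h01, fun p => ?_⟩
  rw [deltaInvariant_two, meanCurvatureVector_separatedCylinder hP hQ h]
  simp

/-! ### The catenoid and the helicoid -/

/-- The cylinder over the catenoid, parametrized on the universal cover. -/
noncomputable def catenoid (m : ℕ) :
    EuclideanSpace ℝ (Fin (m + 2)) → EuclideanSpace ℝ (Fin (m + 2 + 1)) :=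
  separatedCylinder m ![cosh, cosh, fun s => s] ![cos, sin, fun _ => 1]

/-- The cylinder over the helicoid, in the parametrization conjugate to `catenoid`. -/
noncomputable def helicoid (m : ℕ) :
    EuclideanSpace ℝ (Fin (m + 2)) → EuclideanSpace ℝ (Fin (m + 2 + 1)) :=
  separatedCylinder m ![sinh, sinh, fun _ => 1] ![sin, fun t => -cos t, fun t => t]

lemma isIdeal_catenoid (hm : 1 ≤ m) : Riem.IsIdeal (metric m) (catenoid m) := by
  refine isIdeal_separatedCylinder hm ?_ ?_ ?_ ?_ ?_ ?_
  · intro k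
    fin_cases k
    exacts [contDiff_cosh, contDiff_cosh, contDiff_id]
  · intro k
    fin_cases k
    exacts [contDiff_cos, contDiff_sin, contDiff_const]
  · intro s t
    simp [Fin.sum_univ_three]
    linear_combination sinh s ^ 2 * sin_sq_add_cos_sq t - cosh_sq s
  · intro s t
    simp [Fin.sum_univ_three]
    linear_combination cosh s ^ 2 * sin_sq_add_cos_sq t
  · intro s t
    simp [Fin.sum_univ_three]
    ring
  · intro k s t
    fin_cases k <;> simp

lemma isIdeal_helicoid (hm : 1 ≤ m) : Riem.IsIdeal (metric m) (helicoid m) := by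
  refine isIdeal_separatedCylinder hm ?_ ?_ ?_ ?_ ?_ ?_
  · intro k
    fin_cases k
    exacts [contDiff_sinh, contDiff_sinh, contDiff_const]
  · intro k
    fin_cases k
    exacts [contDiff_sin, contDiff_cos.neg, contDiff_id]
  · intro s t
    simp [Fin.sum_univ_three]
    linear_combination cosh s ^ 2 * sin_sq_add_cos_sq t
  · intro s t
    simp [Fin.sum_univ_three]
    linear_combination sinh s ^ 2 * sin_sq_add_cos_sq t - cosh_sq s
  · intro s t
    simp [Fin.sum_univ_three]
    ring
  · intro k s t
    fin_cases k <;> simp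

/-- A congruence would carry the coincidence of the catenoid map at `y₁ = 0` and `y₁ = 2π` over to
the helicoid map, whose third coordinate is `y₁`. -/
lemma not_isCongruent_catenoid_helicoid : ¬ Riem.IsCongruent (catenoid m) (helicoid m) := by
  rintro ⟨Φ, hΦ⟩
  have hc : catenoid m (EuclideanSpace.single 1 (2 * π)) = catenoid m 0 := by
    simp [catenoid, separatedCylinder, assemble_apply]
  have hh : helicoid m (EuclideanSpace.single 1 (2 * π)) = helicoid m 0 := by
    rw [hΦ, Function.comp_apply, hc, Function.comp_apply]
  have h2 := congrArg (fun v : EuclideanSpace ℝ (Fin (m + 2 + 1)) => v 2) hh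
  simp [helicoid, separatedCylinder, assemble_apply, pi_ne_zero] at h2

end CatenoidHelicoid

theorem mainTheorem6 (n : ℕ) (hn : 3 ≤ n) :
    ∃ (M : Type) (_ : TopologicalSpace M) (_ : ChartedSpace (EuclideanSpace ℝ (Fin n)) M)
      (_ : IsManifold (𝓡 n) ∞ M) (_ : T2Space M) (_ : SecondCountableTopology M)
      (_ : ConnectedSpace M) (g : Riem.Metric n M)
      (f₁ f₂ : M → EuclideanSpace ℝ (Fin (n + 1))),
      Riem.IsIdeal g f₁ ∧ Riem.IsIdeal g f₂ ∧ ¬ Riem.IsCongruent f₁ f₂ := by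
  obtain ⟨m, rfl⟩ : ∃ m, n = m + 2 := ⟨n - 2, by omega⟩
  have hm : 1 ≤ m := by omega
  exact ⟨EuclideanSpace ℝ (Fin (m + 2)), inferInstance, chartedSpaceSelf _, inferInstance,
    inferInstance, inferInstance, inferInstance, CatenoidHelicoid.metric m,
    CatenoidHelicoid.catenoid m, CatenoidHelicoid.helicoid m,
    CatenoidHelicoid.isIdeal_catenoid hm, CatenoidHelicoid.isIdeal_helicoid hm,
    CatenoidHelicoid.not_isCongruent_catenoid_helicoid⟩
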